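/- Let $V$ be a vector space of finite dimension $n \ge 0$ over a finite field $F$ with $q$ elements. Let $\Gamma(V)$ be the simple graph whose vertices are the vectors of $V$, two vertices $a, b$ being adjacent if and only if $a \neq b$ and $a, b$ are linearly dependent over $F$. Then the number of spanning trees of $\Gamma(V)$ (that is, of trees with vertex set $V$ all of whose edges are edges of $\Gamma(V)$) is $$q^{(q-2)\left(q^{n-1}+q^{n-2}+\cdots+q+1\right)},$$ where for $n = 0$ the sum in the exponent is empty, i.e. equal to $0$. -/

import Mathlib

/-- The linear dependence graph `Γ(V)` of an `F`-vector space `V`: the vertices are the vectors of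
`V`, and two vectors are adjacent iff they are distinct and linearly dependent. -/
def linearDependenceGraph (F V : Type*) [Field F] [AddCommGroup V] [Module F V] :
    SimpleGraph V where
  Adj a b := a ≠ b ∧ ¬ LinearIndependent F ![a, b]
  symm := ⟨fun a b h => ⟨h.1.symm, fun hl => h.2 (LinearIndependent.pair_symm_iff.mp hl)⟩⟩
  loopless := ⟨fun _ h => h.1 rfl⟩

/-- The spanning trees of a graph `G`: the trees on the whole vertex set of `G`
all of whose edges are edges of `G`. -/
def graphSpanningTrees {V : Type*} (G : SimpleGraph V) : Set (SimpleGraph V) :=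
  {T | T ≤ G ∧ T.IsTree}

/-! Delete the vertex 0, which is adjacent to every other vector: the rest of `Γ(V)` is a disjoint
union of cliques of size q - 1, one per line of `V`. So the Laplacian reduced at 0 is block diagonal
with blocks qI - J, each of determinant q^(q-2), and there are 1 + q + ... + q^(n-1) lines. The
matrix tree theorem then gives the count. For that theorem, orient each spanning tree towards the
root, so that trees become rooted parent maps. Expand the determinant by multilinearity, each row
being a sum over the neighbours of its vertex: a choice of parents contributes 1 if it is rooted and
0 otherwise. -/

/-- A parent assignment to the vertices other than the root `r` is rooted if every vertex can be
given a depth that strictly decreases from a vertex to its parent. -/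
def IsRootedParentMap {V : Type*} {r : V} (f : {v // v ≠ r} → V) : Prop :=
  ∃ d : V → ℕ, ∀ v, d (f v) < d v

/-- The graph joining every vertex other than the root to its parent. -/
def parentGraph {V : Type*} {r : V} (f : {v // v ≠ r} → V) : SimpleGraph V :=
  SimpleGraph.fromRel fun a b => ∃ h : a ≠ r, f ⟨a, h⟩ = b

namespace IsRootedParentMap

variable {V : Type*} {r : V} {f g : {v // v ≠ r} → V}

theorem ne (hf : IsRootedParentMap f) (v : {v // v ≠ r}) : f v ≠ v := by
  obtain ⟨d, hd⟩ := hf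
  exact fun h => (hd v).ne (by rw [h])

theorem adj (hf : IsRootedParentMap f) (v : {v // v ≠ r}) : (parentGraph f).Adj v (f v) :=
  (SimpleGraph.fromRel_adj _ _ _).2 ⟨(hf.ne v).symm, Or.inl ⟨v.2, rfl⟩⟩

theorem connected (hf : IsRootedParentMap f) : (parentGraph f).Connected := by
  obtain ⟨d, hd⟩ := id hf
  have key : ∀ n v, d v = n → (parentGraph f).Reachable v r := by
    intro n
    induction n using Nat.strong_induction_on with
    | _ n ih =>
      intro v hv
      by_cases h : v = r
      · rw [h]
      · have hlt := hd ⟨v, h⟩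
        exact (hf.adj ⟨v, h⟩).reachable.trans (ih _ (hv ▸ hlt) _ rfl)
  have : Nonempty V := ⟨r⟩
  exact ⟨fun a b => (key _ a rfl).trans (key _ b rfl).symm⟩

theorem isTree [Finite V] (hf : IsRootedParentMap f) : (parentGraph f).IsTree := by
  classical
  have := Fintype.ofFinite V
  refine SimpleGraph.isTree_iff_connected_and_card.2 ⟨hf.connected, ?_⟩
  refine le_antisymm ?_ hf.connected.card_vert_le_card_edgeSet_add_one
  have hsub : (parentGraph f).edgeSet ⊆ Set.range fun v : {v // v ≠ r} => s((v : V), f v) := by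
    intro e
    induction e with
    | _ a b =>
      rintro ⟨-, ⟨h, hb⟩ | ⟨h, ha⟩⟩
      · exact ⟨⟨a, h⟩, congrArg (fun u => s(a, u)) hb⟩
      · exact ⟨⟨b, h⟩, (congrArg (fun u => s(b, u)) ha).trans Sym2.eq_swap⟩
  have h1 := Nat.card_mono (Set.toFinite _) hsub
  have h2 : Nat.card (Set.range fun v : {v // v ≠ r} => s((v : V), f v)) ≤
      Nat.card {v // v ≠ r} := Finite.card_range_le _
  have h3 : Nat.card {v // v ≠ r} + 1 = Nat.card V := by
    have : 0 < Fintype.card V := Fintype.card_pos_iff.2 ⟨r⟩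
    simp only [Nat.card_eq_fintype_card, ne_eq, Fintype.card_subtype_compl,
      Fintype.card_subtype_eq]
    omega
  omega

/-- Induction on depth: if the edge from `v` to `f v` came from `g (f v) = v`, then `f (f v) = v` by
induction, and depth would rise. -/
theorem parentGraph_injOn :
    Set.InjOn (parentGraph (r := r)) {f : {v // v ≠ r} → V | IsRootedParentMap f} := by
  intro f hf g hg hfg
  obtain ⟨d, hd⟩ := id hf
  have key : ∀ n (v : {v // v ≠ r}), d v = n → f v = g v := by
    intro n
    induction n using Nat.strong_induction_on with
    | _ n ih =>
      intro v hv
      have hadj : (parentGraph g).Adj v (f v) := hfg ▸ hf.adj v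
      obtain ⟨-, ⟨h, hb⟩ | ⟨h, hb⟩⟩ := hadj
      · exact hb.symm
      · have h1 := hd v
        have h2 := hd ⟨f v, h⟩
        rw [ih _ (hv ▸ h1) ⟨f v, h⟩ rfl, hb] at h2
        exact absurd h1 h2.not_gt
  exact funext fun v => key _ v rfl

end IsRootedParentMap

theorem SimpleGraph.Connected.exists_adj_dist_lt {V : Type*} {G : SimpleGraph V}
    (hG : G.Connected) {v r : V} (h : v ≠ r) : ∃ u, G.Adj v u ∧ G.dist u r < G.dist v r := by
  obtain ⟨w, hw⟩ := hG.exists_walk_length_eq_dist v r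
  cases w with
  | nil => exact absurd rfl h
  | cons hadj p =>
    refine ⟨_, hadj, ?_⟩
    rw [← hw, SimpleGraph.Walk.length_cons]
    exact Nat.lt_succ_of_le (SimpleGraph.dist_le p)

/-- The spanning trees are the parent graphs of the rooted parent assignments along edges. -/
theorem graphSpanningTrees_eq_image {V : Type*} [Finite V] (G : SimpleGraph V) (r : V) :
    graphSpanningTrees G = parentGraph (r := r) ''
      {f | (∀ v : {v // v ≠ r}, G.Adj v (f v)) ∧ IsRootedParentMap f} := by
  ext T
  constructor
  · rintro ⟨hle, hT⟩
    choose f hadj hdist using fun v : {v // v ≠ r} =>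
      hT.connected.exists_adj_dist_lt v.2
    have hf : IsRootedParentMap f := ⟨fun v => T.dist v r, hdist⟩
    refine ⟨f, ⟨fun v => hle (hadj v), hf⟩, ?_⟩
    -- A tree has no proper connected spanning subgraph.
    refine (SimpleGraph.isTree_iff_minimal_connected.1 hT).eq_of_le hf.connected ?_
    rintro a b ⟨-, ⟨h, hb⟩ | ⟨h, hb⟩⟩
    · exact hb ▸ hadj ⟨a, h⟩
    · exact hb ▸ (hadj ⟨b, h⟩).symm
  · rintro ⟨f, ⟨hadj, hf⟩, rfl⟩
    refine ⟨?_, hf.isTree⟩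
    rintro a b ⟨-, ⟨h, hb⟩ | ⟨h, hb⟩⟩
    · exact hb ▸ hadj ⟨a, h⟩
    · exact hb ▸ (hadj ⟨b, h⟩).symm

section MatrixTree

variable {V : Type*} [Fintype V] [DecidableEq V] {r : V}

/-- The reduced Laplacian matrix of the directed graph of a parent assignment. -/
def parentMatrix (f : {v // v ≠ r} → V) : Matrix {v // v ≠ r} {v // v ≠ r} ℤ :=
  fun v w => (if w = v then 1 else 0) - if (w : V) = f v then 1 else 0

/-- Ordered by depth, the matrix is block triangular with identity diagonal blocks. -/
theorem IsRootedParentMap.det_parentMatrix {f : {v // v ≠ r} → V} (hf : IsRootedParentMap f) :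
    (parentMatrix f).det = 1 := by
  obtain ⟨d, hd⟩ := hf
  have hM : (parentMatrix f).BlockTriangular fun v => OrderDual.toDual (d v) := by
    intro v w hvw
    have hvw : d v < d w := hvw
    have h1 : w ≠ v := by rintro rfl; exact hvw.false
    have h2 : (w : V) ≠ f v := fun h => (hd v).not_gt (h ▸ hvw)
    simp [parentMatrix, h1, h2]
  rw [hM.det]
  refine Finset.prod_eq_one fun a _ => ?_
  refine (congrArg Matrix.det (Matrix.ext ?_)).trans Matrix.det_one
  rintro ⟨v, hv⟩ ⟨w, hw⟩
  have hvw : d v = d w := OrderDual.toDual.injective (hv.trans hw.symm)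
  have h2 : (w : V) ≠ f v := fun h => (hd v).ne (h ▸ hvw.symm)
  simp [parentMatrix, Matrix.toSquareBlock_def, Matrix.one_apply, h2, eq_comm]

/-- Some vertex never reaches the root. The indicator of all such vertices lies in the kernel, since
`v` is one exactly when its parent is. -/
theorem det_parentMatrix_eq_zero {f : {v // v ≠ r} → V} (hf : ¬ IsRootedParentMap f) :
    (parentMatrix f).det = 0 := by
  classical
  let s : V → V := fun v => if h : v = r then r else f ⟨v, h⟩
  have hs : ∀ v : {v // v ≠ r}, s v = f v := fun v => dif_neg v.2
  have hx : ∃ x, ∀ k, s^[k] x ≠ r := by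
    by_contra! h
    refine hf ⟨fun v => Nat.find (h v), fun v => ?_⟩
    have hpos : Nat.find (h v) ≠ 0 := fun h0 => v.2 ((Nat.find_eq_zero _).1 h0)
    obtain ⟨k, hk⟩ := Nat.exists_eq_succ_of_ne_zero hpos
    have hsp := Nat.find_spec (h v)
    rw [hk, Function.iterate_succ_apply, hs] at hsp
    exact (Nat.find_min' (h (f v)) hsp).trans_lt (hk.symm ▸ Nat.lt_succ_self k : k < Nat.find (h v))
  obtain ⟨x, hx⟩ := hx
  refine Matrix.exists_mulVec_eq_zero_iff.1
    ⟨fun v => if ∀ k, s^[k] v ≠ r then 1 else 0, fun h => ?_, ?_⟩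
  · have := congrFun h ⟨x, hx 0⟩
    simp [hx] at this
  · ext v
    have hstep : (∀ k, s^[k] (v : V) ≠ r) ↔ ∀ k, s^[k] (f v) ≠ r := by
      rw [← hs v]
      refine ⟨fun h k => h (k + 1), fun h k => ?_⟩
      cases k with
      | zero => exact v.2
      | succ k => exact h k
    simp only [Matrix.mulVec, dotProduct, parentMatrix, sub_mul, ite_mul, one_mul, zero_mul,
      Finset.sum_sub_distrib, Finset.sum_ite_eq', Finset.mem_univ, if_true, Pi.zero_apply]
    by_cases hr : f v = r
    · have h0 : ¬ ∀ k, s^[k] (v : V) ≠ r := fun h => h 1 ((hs v).trans hr)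
      rw [if_neg h0, Finset.sum_eq_zero, sub_zero]
      intro w _
      rw [if_neg fun h => w.2 (h.trans hr)]
    · rw [Finset.sum_eq_single ⟨f v, hr⟩]
      · simp only [if_true, hstep, sub_self]
      · intro w _ hw
        rw [if_neg fun h => hw (Subtype.ext h)]
      · simp

theorem lapMatrix_row_eq_sum (G : SimpleGraph V) [DecidableRel G.Adj] (v w : {v // v ≠ r}) :
    G.lapMatrix ℤ v w =
      ∑ u ∈ G.neighborFinset v, ((if w = v then 1 else 0) - if (w : V) = u then 1 else 0) := by
  simp [SimpleGraph.lapMatrix, SimpleGraph.degMatrix, Matrix.diagonal_apply, Subtype.ext_iff,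
    eq_comm (a := (v : V))]

/-- Kirchhoff's **matrix tree theorem**. -/
theorem ncard_graphSpanningTrees_eq_det (G : SimpleGraph V) [DecidableRel G.Adj] (r : V) :
    ((graphSpanningTrees G).ncard : ℤ) =
      ((G.lapMatrix ℤ).submatrix (Subtype.val : {v // v ≠ r} → V) Subtype.val).det := by
  classical
  have hdet : ((G.lapMatrix ℤ).submatrix (Subtype.val : {v // v ≠ r} → V) Subtype.val).det =
      ∑ f ∈ Fintype.piFinset fun v : {v // v ≠ r} => G.neighborFinset v,
        (parentMatrix f).det := by
    have := (Matrix.detRowAlternating (n := {v // v ≠ r}) (R := ℤ)).toMultilinearMap.map_sum_finset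
      (fun v u w => (if w = v then 1 else 0) - if (w : V) = u then 1 else 0)
      (fun v => G.neighborFinset v)
    refine Eq.trans ?_ this
    refine congrArg Matrix.det (Matrix.ext fun v w => ?_)
    rw [Matrix.submatrix_apply, lapMatrix_row_eq_sum, Finset.sum_apply]
  rw [hdet, graphSpanningTrees_eq_image G r,
    (IsRootedParentMap.parentGraph_injOn.mono fun f hf => hf.2).ncard_image]
  have hset : {f | (∀ v : {v // v ≠ r}, G.Adj v (f v)) ∧ IsRootedParentMap f} =
      ((Fintype.piFinset fun v : {v // v ≠ r} => G.neighborFinset v).filter IsRootedParentMap :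
        Finset ({v // v ≠ r} → V)) := by
    ext f
    simp
  rw [hset, Set.ncard_coe_finset, Finset.card_filter, Nat.cast_sum]
  refine Finset.sum_congr rfl fun f _ => ?_
  split_ifs with hf
  · rw [hf.det_parentMatrix, Nat.cast_one]
  · rw [det_parentMatrix_eq_zero hf, Nat.cast_zero]

end MatrixTree

open scoped LinearAlgebra.Projectivization

theorem fst_nonZeroEquivProjectivizationProdUnits (F V : Type*) [Field F]
    [AddCommGroup V] [Module F V] (v : {v : V // v ≠ 0}) :
    (Projectivization.nonZeroEquivProjectivizationProdUnits F V v).1 =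
      Projectivization.mk F v.1 v.2 :=
  rfl

/-- This is the characteristic polynomial X^(q-1) - (q-1)X^(q-2) of the rank-one matrix J, evaluated
at q. -/
theorem det_smul_one_sub_allOnes {m : Type*} [Fintype m] [DecidableEq m] (q : ℕ)
    (hm : Fintype.card m = q - 1) (hq : 2 ≤ q) :
    (Matrix.of fun i j : m => (if i = j then (q : ℤ) else 0) - 1).det = q ^ (q - 2) := by
  have h := Matrix.eval_charpoly (Matrix.vecMulVec (1 : m → ℤ) 1) (q : ℤ)
  rw [Matrix.charpoly_vecMulVec] at h
  convert h.symm using 1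
  · congr 1
  · obtain ⟨k, rfl⟩ := Nat.exists_eq_add_of_le' hq
    simp [hm]
    ring

theorem linearDependenceGraph_adj_iff {F V : Type*} [Field F] [AddCommGroup V]
    [Module F V] {v : V} (hv : v ≠ 0) (w : V) :
    (linearDependenceGraph F V).Adj v w ↔ v ≠ w ∧ ∃ c : F, c • v = w := by
  show _ ∧ _ ↔ _
  rw [LinearIndependent.pair_iff' hv]
  push Not
  rfl

theorem linearDependenceGraph_degree {F V : Type*} [Field F] [Fintype F] [AddCommGroup V]
    [Module F V] [Fintype V] [DecidableEq V] [DecidableRel (linearDependenceGraph F V).Adj]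
    {v : V} (hv : v ≠ 0) :
    (linearDependenceGraph F V).degree v = Fintype.card F - 1 := by
  have : (linearDependenceGraph F V).neighborFinset v =
      (Finset.univ.image fun c : F => c • v).erase v := by
    ext w
    simp [linearDependenceGraph_adj_iff hv, eq_comm]
  rw [← SimpleGraph.card_neighborFinset_eq_degree, this, Finset.card_erase_of_mem,
    Finset.card_image_of_injective _ (smul_left_injective F hv), Finset.card_univ]
  exact Finset.mem_image.2 ⟨1, Finset.mem_univ _, one_smul F v⟩

theorem mainTheorem5 {F V : Type*} [Field F] [Finite F] [AddCommGroup V] [Module F V]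
    [FiniteDimensional F V] (q n : ℕ) (hq : Nat.card F = q) (hn : Module.finrank F V = n) :
    (graphSpanningTrees (linearDependenceGraph F V)).ncard =
      q ^ ((q - 2) * ∑ i ∈ Finset.range n, q ^ i) := by
  classical
  have := Fintype.ofFinite F
  have : Finite V := Module.finite_of_finite F
  have := Fintype.ofFinite V
  have := Fintype.ofFinite (ℙ F V)
  have hqF : Fintype.card F = q := by rw [← hq, Nat.card_eq_fintype_card]
  have hq2 : 2 ≤ q := hqF ▸ Fintype.one_lt_card
  let e := Projectivization.nonZeroEquivProjectivizationProdUnits F V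
  let M : Matrix Fˣ Fˣ ℤ := Matrix.of fun i j => (if i = j then (q : ℤ) else 0) - 1
  have hM : ((linearDependenceGraph F V).lapMatrix ℤ).submatrix
      (Subtype.val : {v : V // v ≠ 0} → V) Subtype.val =
      (Matrix.blockDiagonal fun _ : ℙ F V => M).submatrix
        (e.trans (Equiv.prodComm _ _)) (e.trans (Equiv.prodComm _ _)) := by
    ext v w
    have hline : (e v).1 = (e w).1 ↔ ∃ c : F, c • (v : V) = w := by
      rw [fst_nonZeroEquivProjectivizationProdUnits, fst_nonZeroEquivProjectivizationProdUnits,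
        eq_comm, Projectivization.mk_eq_mk_iff']
    have hvw : v = w ↔ (e v).1 = (e w).1 ∧ (e v).2 = (e w).2 := by
      rw [← Prod.ext_iff, e.apply_eq_iff_eq]
    -- The degree counts the edge to 0, so the diagonal entry q - 1 is that of qI - J.
    have hdeg : (((linearDependenceGraph F V).degree v : ℕ) : ℤ) = q - 1 := by
      rw [linearDependenceGraph_degree v.2, hqF, Nat.cast_sub (by omega), Nat.cast_one]
    have hadj := linearDependenceGraph_adj_iff (F := F) v.2 w
    rw [← hline, ne_eq, ← Subtype.ext_iff, hvw] at hadj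
    have hvw' : (v : V) = w ↔ (e v).1 = (e w).1 ∧ (e v).2 = (e w).2 := by
      rw [← Subtype.ext_iff, hvw]
    simp only [Matrix.submatrix_apply, SimpleGraph.lapMatrix, SimpleGraph.degMatrix,
      Matrix.sub_apply, Matrix.diagonal_apply, SimpleGraph.adjMatrix_apply, hadj, hvw', hdeg,
      Equiv.trans_apply, Equiv.prodComm_apply, Matrix.blockDiagonal_apply, Prod.fst_swap,
      Prod.snd_swap, M, Matrix.of_apply]
    by_cases h1 : (e v).1 = (e w).1 <;> by_cases h2 : (e v).2 = (e w).2 <;> simp [h1, h2]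
  have hdet := ncard_graphSpanningTrees_eq_det (linearDependenceGraph F V) 0
  rw [hM, Matrix.det_submatrix_equiv_self, Matrix.det_blockDiagonal, Finset.prod_const,
    det_smul_one_sub_allOnes q (by rw [Fintype.card_units, hqF]) hq2, Finset.card_univ,
    ← Nat.card_eq_fintype_card, Projectivization.card_of_finrank F V hn, hq, ← pow_mul] at hdet
  exact_mod_cast hdet
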